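/- Semigroups are nonempty. A pseudovariety of semigroups is a class of finite semigroups closed under taking subsemigroups, homomorphic images and finite direct products. Let $\mathsf{LI}$ be the pseudovariety of finite semigroups $S$ all of whose local monoids $eSe$ ($e\in S$ idempotent) are trivial. For pseudovarieties $\mathsf W,\mathsf V$, the Mal'cev product $\mathsf W\mathbin{\text{ⓜ}}\mathsf V$ is the pseudovariety generated by the finite semigroups $S$ that admit a homomorphism $f\colon S\to T$ with $T\in\mathsf V$ such that, for every idempotent $e\in T$, the semigroup $f^{-1}(e)$, if nonempty, belongs to $\mathsf W$. A semigroup $S$ is equidivisible if, for all $u,v,x,y\in S$ with $uv=xy$, either $u=x$ and $v=y$, or there is $t\in S$ with $ut=x$ and $v=ty$, or there is $t\in S$ with $xt=u$ and $y=tv$. A pseudovariety $\mathsf V$ is equidivisible if, for every finite nonempty alphabet $A$, the free pro-$\mathsf V$ semigroup on $A$ (the inverse limit of the $A$-generated members of $\mathsf V$) is equidivisible. **Corollary.** If $\mathsf V$ is a pseudovariety of semigroups such that $\mathsf V=\mathsf{LI}\mathbin{\text{ⓜ}}\mathsf V$, then $\mathsf V$ is equidivisible. -/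

import Mathlib

universe u

/-- A pseudovariety of semigroups: a class of finite (nonempty) semigroups closed under taking
subsemigroups, homomorphic images and finite direct products, the empty product included. -/
@[ext]
structure SgPseudovariety where
  Mem : (S : Type u) → [Semigroup S] → Prop
  finite_of_mem : ∀ (S : Type u) [Semigroup S], Mem S → Finite S
  nonempty_of_mem : ∀ (S : Type u) [Semigroup S], Mem S → Nonempty S
  mem_sub : ∀ (S : Type u) [Semigroup S] (T : Subsemigroup S), Nonempty T → Mem S → Mem T
  mem_image : ∀ (S T : Type u) [Semigroup S] [Semigroup T] (f : S →ₙ* T),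
    Function.Surjective f → Mem S → Mem T
  mem_unit : Mem PUnit.{u + 1}
  mem_prod : ∀ (S T : Type u) [Semigroup S] [Semigroup T], Mem S → Mem T → Mem (S × T)

namespace SgPseudovariety

/-- The pseudovariety generated by a class `P` of finite nonempty semigroups: the intersection of
all the pseudovarieties that contain `P`. (Infinite or empty semigroups in `P` are ignored.) -/
def generate (P : (S : Type u) → [Semigroup S] → Prop) : SgPseudovariety.{u} where
  Mem S _ := Finite S ∧ Nonempty S ∧
    ∀ W : SgPseudovariety.{u},
      (∀ (T : Type u) [Semigroup T], Finite T → Nonempty T → P T → W.Mem T) → W.Mem S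
  finite_of_mem _ _ h := h.1
  nonempty_of_mem _ _ h := h.2.1
  mem_sub S _ T hT h :=
    ⟨@Subtype.finite _ h.1 _, hT, fun W hW => W.mem_sub S T hT (h.2.2 W hW)⟩
  mem_image S T _ _ f hf h :=
    ⟨@Finite.of_surjective _ _ h.1 f hf, h.2.1.map f,
      fun W hW => W.mem_image S T f hf (h.2.2 W hW)⟩
  mem_unit := ⟨inferInstance, inferInstance, fun W _ => W.mem_unit⟩
  mem_prod S T _ _ hS hT :=
    ⟨@Finite.instProd _ _ hS.1 hT.1, @instNonemptyProd _ _ hS.2.1 hT.2.1,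
      fun W hW => W.mem_prod S T (hS.2.2 W hW) (hT.2.2 W hW)⟩

end SgPseudovariety

/-- The underlying set `eSe` of the local monoid of `S` at an idempotent `e`. -/
def localMonoid {S : Type u} [Semigroup S] (e : S) : Set S :=
  Set.range fun s => e * s * e

/-- All the local monoids `eSe` (for `e` idempotent) are trivial. -/
def IsLocallyTrivial (S : Type u) [Semigroup S] : Prop :=
  ∀ e : S, IsIdempotentElem e → (localMonoid e).Subsingleton

/-- The fiber `f ⁻¹(e)` of a semigroup homomorphism over an idempotent, as a subsemigroup. -/
def idempotentFiber {S T : Type u} [Semigroup S] [Semigroup T] (f : S →ₙ* T) (e : T)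
    (he : IsIdempotentElem e) : Subsemigroup S where
  carrier := {s | f s = e}
  mul_mem' {a b} (ha : f a = e) (hb : f b = e) := by
    change f (a * b) = e
    rw [map_mul, ha, hb, he.eq]

theorem exists_idempotent_of_finite (S : Type u) [Semigroup S] [Finite S] [Nonempty S] :
    ∃ e : S, IsIdempotentElem e := by
  let : TopologicalSpace S := ⊥
  have : DiscreteTopology S := ⟨rfl⟩
  exact exists_idempotent_of_compact_t2_of_continuous_mul_left
    (fun _ => continuous_of_discreteTopology)

/-- The pseudovariety `LI` of finite locally trivial semigroups. -/
def pvLI : SgPseudovariety.{u} where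
  Mem S _ := Finite S ∧ Nonempty S ∧ IsLocallyTrivial S
  finite_of_mem _ _ h := h.1
  nonempty_of_mem _ _ h := h.2.1
  mem_sub S _ T hT h := by
    refine ⟨@Subtype.finite _ h.1 _, hT, ?_⟩
    rintro e he _ ⟨x, rfl⟩ _ ⟨y, rfl⟩
    exact Subtype.ext (h.2.2 (e : S) (congrArg Subtype.val he) ⟨x, rfl⟩ ⟨y, rfl⟩)
  mem_image S T _ _ f hf h := by
    obtain ⟨hfin, hne, hl⟩ := h
    refine ⟨Finite.of_surjective f hf, hne.map f, ?_⟩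
    rintro e he _ ⟨x, rfl⟩ _ ⟨y, rfl⟩
    obtain ⟨s, hs⟩ := hf e
    have : Nonempty (idempotentFiber f e he) := ⟨⟨s, hs⟩⟩
    obtain ⟨⟨g, hg⟩, hgi⟩ := exists_idempotent_of_finite (idempotentFiber f e he)
    obtain ⟨a, rfl⟩ := hf x
    obtain ⟨b, rfl⟩ := hf y
    obtain rfl : f g = e := hg
    have := congrArg f (hl g (congrArg Subtype.val hgi) ⟨a, rfl⟩ ⟨b, rfl⟩)
    simpa only [map_mul] using this
  mem_unit := ⟨inferInstance, inferInstance, fun _ _ _ _ _ _ => rfl⟩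
  mem_prod S T _ _ hS hT := by
    refine ⟨@Finite.instProd _ _ hS.1 hT.1, @instNonemptyProd _ _ hS.2.1 hT.2.1, ?_⟩
    rintro e he _ ⟨x, rfl⟩ _ ⟨y, rfl⟩
    exact Prod.ext
      (hS.2.2 e.1 (congrArg Prod.fst he) ⟨x.1, rfl⟩ ⟨y.1, rfl⟩)
      (hT.2.2 e.2 (congrArg Prod.snd he) ⟨x.2, rfl⟩ ⟨y.2, rfl⟩)

/-- The Mal'cev product of `W` and `V`: the pseudovariety generated by the finite semigroups `S`
that have a homomorphism `f : S → T` into a member `T` of `V` such that, for every idempotent `e`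
of `T`, the subsemigroup `f ⁻¹(e)` of `S` belongs to `W` whenever it is nonempty. -/
def malcevProduct (W V : SgPseudovariety.{u}) : SgPseudovariety.{u} :=
  SgPseudovariety.generate fun S _ =>
    ∃ (T : Type u) (_ : Semigroup T) (f : S →ₙ* T), V.Mem T ∧
      ∀ (e : T) (he : IsIdempotentElem e),
        Nonempty (idempotentFiber f e he) → W.Mem (idempotentFiber f e he)

/-- A semigroup is equidivisible if any two factorizations `u * v = x * y` of an element into two
factors coincide or have a common refinement. -/
def IsEquidivisible (S : Type u) [Semigroup S] : Prop :=
  ∀ u v x y : S, u * v = x * y →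
    (u = x ∧ v = y) ∨ (∃ t, u * t = x ∧ v = t * y) ∨ (∃ t, x * t = u ∧ y = t * v)

/-- The canonical map between quotients of a semigroup by comparable congruences. -/
def conTransition {M : Type u} [Semigroup M] (c d : Con M) (h : c ≤ d) (q : c.Quotient) :
    d.Quotient :=
  Con.liftOn q (fun w => (w : d.Quotient)) fun _ _ hab => (Con.eq d).2 (h hab)

theorem conTransition_mul {M : Type u} [Semigroup M] (c d : Con M) (h : c ≤ d)
    (p q : c.Quotient) :
    conTransition c d h (p * q) = conTransition c d h p * conTransition c d h q := by
  induction p, q using Con.induction_on₂ with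
  | H a b => rfl

/-- The free pro-`V` semigroup on the alphabet `A`: the inverse limit of all the `A`-generated
members of `V`, that is, of the quotients of the free semigroup on `A` that belong to `V`. It is
realized as the semigroup of compatible families in the product of these quotients. (Its topology,
induced by the product of the discrete topologies, plays no role in equidivisibility.) -/
def freePro (V : SgPseudovariety.{u}) (A : Type u) :
    Subsemigroup (∀ c : {c : Con (FreeSemigroup A) // V.Mem c.Quotient}, c.1.Quotient) where
  carrier := {x | ∀ (c d : {c : Con (FreeSemigroup A) // V.Mem c.Quotient}) (h : c.1 ≤ d.1),
    conTransition c.1 d.1 h (x c) = x d}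
  mul_mem' {x y} hx hy c d h := by
    rw [Pi.mul_apply, Pi.mul_apply, conTransition_mul, hx c d h, hy c d h]

/-- A pseudovariety is equidivisible if every finitely generated free pro-`V` semigroup is. -/
def SgPseudovariety.IsEquidivisible (V : SgPseudovariety.{u}) : Prop :=
  ∀ (A : Type u) [Finite A] [Nonempty A], _root_.IsEquidivisible (freePro V A)

/-! Let `S` be an `A`-generated member of `V`. Reading a word, its cuts into two factors trace a
path in the two-sided Cayley graph of `S` with an identity adjoined. Recording the value of the word
together with the strongly connected components met by this path gives a finite expansion of `S`.
Its fibers over idempotents are locally trivial (`visited_conj_subset`), so it lies in `LI` ⓜ `V`,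
hence in `V`.

If `u * v` and `x * y` agree in the expansion, their images in `S` have a common refinement
(`Shifts.of_visited_eq`), since the cuts of a single word are linearly ordered. Thus equality in the
free pro-`V` semigroup gives a refinement in every finite quotient, and compactness assembles these
into a global one (`exists_shift`). -/

/-! ### Shifts of factorizations and visited components -/

section Factorizations

variable {N : Type*} [Monoid N]

/-- The pair `q` arises from `p` by moving a left factor of the second component of `p` to the
first component. -/
def Shifts (p q : N × N) : Prop :=
  ∃ r, p.1 * r = q.1 ∧ p.2 = r * q.2

theorem Shifts.trans {p q s : N × N} (hpq : Shifts p q) (hqs : Shifts q s) : Shifts p s := by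
  obtain ⟨r, h₁, h₂⟩ := hpq
  obtain ⟨t, h₃, h₄⟩ := hqs
  exact ⟨r * t, by rw [← mul_assoc, h₁, h₃], by rw [h₂, h₄, mul_assoc]⟩

theorem Shifts.refl (p : N × N) : Shifts p p :=
  ⟨1, mul_one _, (one_mul _).symm⟩

theorem Shifts.mul_right {a b a' b' : N} (h : Shifts (a, b) (a', b')) (n : N) :
    Shifts (a, b * n) (a', b' * n) := by
  obtain ⟨r, h₁, h₂⟩ := h
  exact ⟨r, h₁, by simp only at h₂ ⊢; rw [h₂, mul_assoc]⟩

theorem Shifts.mul_left {a b a' b' : N} (h : Shifts (a, b) (a', b')) (n : N) :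
    Shifts (n * a, b) (n * a', b') := by
  obtain ⟨r, h₁, h₂⟩ := h
  exact ⟨r, by simp only at h₁ ⊢; rw [← h₁, mul_assoc], h₂⟩

variable {A : Type*}

theorem FreeMonoid.mul_eq_mul_cases {a b m n : FreeMonoid A} (h : a * b = m * n) :
    (∃ r, a * r = m ∧ b = r * n) ∨ ∃ r, m * r = a ∧ n = r * b := by
  rcases List.append_eq_append_iff.1 h with ⟨r, h₁, h₂⟩ | ⟨r, h₁, h₂⟩
  · exact Or.inl ⟨r, h₁.symm, h₂⟩
  · exact Or.inr ⟨r, h₁.symm, h₂⟩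

/-- The pairs that are mutually reachable, by shifts, with the image of a factorization of `m`:
the strongly connected components visited by `m` in the two-sided Cayley graph of `φ`. -/
def visited (φ : FreeMonoid A →* N) (m : FreeMonoid A) : Set (N × N) :=
  {p | ∃ a b, a * b = m ∧ Shifts (φ a, φ b) p ∧ Shifts p (φ a, φ b)}

theorem mem_visited (φ : FreeMonoid A →* N) (a b : FreeMonoid A) :
    (φ a, φ b) ∈ visited φ (a * b) :=
  ⟨a, b, rfl, .refl _, .refl _⟩

/-- A cut of a product falls inside one of the factors, and multiplying by the image of the other
factor preserves mutual reachability. -/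
theorem visited_mul_subset (φ : FreeMonoid A →* N) {m m' n n' : FreeMonoid A}
    (hm : φ m = φ m') (hn : φ n = φ n') (hvm : visited φ m ⊆ visited φ m')
    (hvn : visited φ n ⊆ visited φ n') : visited φ (m * n) ⊆ visited φ (m' * n') := by
  rintro p ⟨a, b, hab, h₁, h₂⟩
  rcases FreeMonoid.mul_eq_mul_cases hab with ⟨r, rfl, rfl⟩ | ⟨r, rfl, rfl⟩
  · obtain ⟨a', r', rfl, h₃, h₄⟩ := hvm (mem_visited φ a r)
    refine ⟨a', r' * n', (mul_assoc _ _ _).symm, ?_, ?_⟩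
    · refine .trans ?_ h₁
      simpa only [map_mul, hn] using h₃.mul_right (φ n')
    · refine h₂.trans ?_
      simpa only [map_mul, hn] using h₄.mul_right (φ n')
  · obtain ⟨r', b', rfl, h₃, h₄⟩ := hvn (mem_visited φ r b)
    refine ⟨m' * r', b', mul_assoc _ _ _, ?_, ?_⟩
    · refine .trans ?_ h₁
      simpa only [map_mul, hm] using h₃.mul_left (φ m')
    · refine h₂.trans ?_
      simpa only [map_mul, hm] using h₄.mul_left (φ m')

/-- The congruence that identifies two words with the same image and the same visited strongly
connected components: a variant of the two-sided Karnofsky–Rhodes expansion. -/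
def expansionCon (φ : FreeMonoid A →* N) : Con (FreeMonoid A) where
  r m m' := φ m = φ m' ∧ visited φ m = visited φ m'
  iseqv := ⟨fun _ => ⟨rfl, rfl⟩, fun h => ⟨h.1.symm, h.2.symm⟩,
    fun h k => ⟨h.1.trans k.1, h.2.trans k.2⟩⟩
  mul' h k := ⟨by rw [map_mul, map_mul, h.1, k.1],
    (visited_mul_subset φ h.1 k.1 h.2.le k.2.le).antisymm
      (visited_mul_subset φ h.1.symm k.1.symm h.2.ge k.2.ge)⟩

/-- Only cuts inside the middle word could tell the two products apart, and these all lie in the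
component of `(φ w, φ w)`. -/
theorem visited_conj_subset (φ : FreeMonoid A →* N) {w a b : FreeMonoid A}
    (hw : IsIdempotentElem (φ w)) (ha : φ a = φ w) (hb : φ b = φ w) :
    visited φ (w * a * w) ⊆ visited φ (w * b * w) := by
  rintro p ⟨x, y, hxy, h₁, h₂⟩
  have hee : φ w * φ w = φ w := hw
  rcases FreeMonoid.mul_eq_mul_cases hxy with ⟨r, hr, rfl⟩ | ⟨r, rfl, hr⟩
  · rcases FreeMonoid.mul_eq_mul_cases hr with ⟨s, rfl, rfl⟩ | ⟨s, rfl, rfl⟩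
    -- Cut inside the first `w`, here `x * s`: the same cut serves, as `a` and `b` have equal
    -- images.
    · have h : φ (s * b * (x * s)) = φ (s * a * (x * s)) := by
        rw [map_mul, map_mul φ s, hb, ← ha, ← map_mul φ s, ha, ← map_mul]
      exact ⟨x, s * b * (x * s), by simp only [mul_assoc], h ▸ h₁, h ▸ h₂⟩
    -- Cut inside `a = s * r`: it is replaced by the cut between `w` and `b * w`. Shifting by `φ s`
    -- leads to the old cut and shifting by `φ r` leads back.
    · have hsr : φ s * φ r = φ w := by rw [← map_mul, ha]
      refine ⟨_, b * _, (mul_assoc _ _ _).symm, .trans ⟨φ s, ?_, ?_⟩ h₁,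
        h₂.trans ⟨φ r, ?_, ?_⟩⟩
      · simp only [map_mul]
      · simp only [map_mul, hb, ← mul_assoc, hsr]
      · simp only [map_mul, mul_assoc, hsr, hee]
      · simp only [map_mul, hb, hee]
  -- Cut inside the last `w`, symmetric to the first case.
  · refine ⟨w * b * r, y, by rw [mul_assoc, ← hr], ?_, ?_⟩
    · simpa only [map_mul, ha, hb] using h₁
    · simpa only [map_mul, ha, hb] using h₂

theorem expansionCon_conj (φ : FreeMonoid A →* N) {w a b : FreeMonoid A}
    (hw : IsIdempotentElem (φ w)) (ha : φ a = φ w) (hb : φ b = φ w) :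
    expansionCon φ (w * a * w) (w * b * w) :=
  ⟨by simp only [map_mul, ha, hb],
    (visited_conj_subset φ hw ha hb).antisymm (visited_conj_subset φ hw hb ha)⟩

/-- The pair `(φ x, φ y)` is mutually reachable with some cut of `u * v`, and that cut is comparable
with the cut between `u` and `v`. -/
theorem Shifts.of_visited_eq (φ : FreeMonoid A →* N) {u v x y : FreeMonoid A}
    (h : visited φ (u * v) = visited φ (x * y)) :
    Shifts (φ u, φ v) (φ x, φ y) ∨ Shifts (φ x, φ y) (φ u, φ v) := by
  obtain ⟨a, b, hab, h₁, h₂⟩ : (φ x, φ y) ∈ visited φ (u * v) := h ▸ mem_visited φ x y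
  rcases FreeMonoid.mul_eq_mul_cases hab with ⟨r, rfl, rfl⟩ | ⟨r, rfl, rfl⟩
  · exact Or.inr (h₂.trans ⟨φ r, (map_mul φ _ _).symm, map_mul φ _ _⟩)
  · exact Or.inl (.trans ⟨φ r, (map_mul φ _ _).symm, map_mul φ _ _⟩ h₁)

end Factorizations

/-! ### The expansion of a finite `A`-generated semigroup -/

/-- The extension of the quotient map of a congruence on the free semigroup to the free monoid. -/
def quotientLift {A : Type*} (c : Con (FreeSemigroup A)) : FreeMonoid A →* WithOne c.Quotient :=
  FreeMonoid.lift fun a => ((FreeSemigroup.of a : c.Quotient) : WithOne c.Quotient)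

theorem quotientLift_toFreeMonoid {A : Type*} (c : Con (FreeSemigroup A)) (w : FreeSemigroup A) :
    quotientLift c w.toFreeMonoid = ((w : c.Quotient) : WithOne c.Quotient) := by
  induction w using FreeSemigroup.recOnMul with
  | ih1 a => rfl
  | ih2 a w ha hw => rw [map_mul, map_mul, ha, hw, Con.coe_mul, WithOne.coe_mul]

/-- The expansion of an `A`-generated semigroup, given as a congruence on the free semigroup. -/
def expansion {A : Type*} (c : Con (FreeSemigroup A)) : Con (FreeSemigroup A) :=
  (expansionCon (quotientLift c)).comap FreeSemigroup.toFreeMonoid (map_mul _)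

theorem expansion_iff {A : Type*} {c : Con (FreeSemigroup A)} {w w' : FreeSemigroup A} :
    expansion c w w' ↔ (w : c.Quotient) = w' ∧
      visited (quotientLift c) w.toFreeMonoid = visited (quotientLift c) w'.toFreeMonoid := by
  rw [← WithOne.coe_inj, ← quotientLift_toFreeMonoid, ← quotientLift_toFreeMonoid]
  rfl

theorem expansion_le {A : Type*} (c : Con (FreeSemigroup A)) : expansion c ≤ c :=
  fun _ _ h => (Con.eq c).1 (expansion_iff.1 h).1

theorem finite_expansion {A : Type*} (c : Con (FreeSemigroup A)) [Finite c.Quotient] :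
    Finite (expansion c).Quotient := by
  have : Finite (WithOne c.Quotient) := inferInstanceAs (Finite (Option c.Quotient))
  let f : (expansion c).Quotient →
      c.Quotient × Set (WithOne c.Quotient × WithOne c.Quotient) := fun q =>
    Con.liftOn q (fun w => ((w : c.Quotient), visited (quotientLift c) w.toFreeMonoid))
      fun _ _ h => Prod.ext (expansion_iff.1 h).1 (expansion_iff.1 h).2
  refine Finite.of_injective f fun p q => ?_
  induction p, q using Con.induction_on₂ with
  | H w w' => exact fun h =>
      (Con.eq _).2 (expansion_iff.2 ⟨congrArg Prod.fst h, congrArg Prod.snd h⟩)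

/-- The canonical homomorphism between quotients of a semigroup by comparable congruences. -/
def conTransitionHom {M : Type u} [Semigroup M] {c d : Con M} (h : c ≤ d) :
    c.Quotient →ₙ* d.Quotient :=
  ⟨conTransition c d h, conTransition_mul c d h⟩

theorem isLocallyTrivial_idempotentFiber_expansion {A : Type u} (c : Con (FreeSemigroup A))
    (e : c.Quotient) (he : IsIdempotentElem e) :
    IsLocallyTrivial (idempotentFiber (conTransitionHom (expansion_le c)) e he) := by
  rintro ⟨g, hg⟩ - _ ⟨⟨a, ha⟩, rfl⟩ _ ⟨⟨b, hb⟩, rfl⟩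
  refine Subtype.ext (?_ : g * a * g = g * b * g)
  induction g using Con.induction_on with | H w => ?_
  induction a using Con.induction_on with | H a => ?_
  induction b using Con.induction_on with | H b => ?_
  replace hg : (w : c.Quotient) = e := hg
  replace ha : (a : c.Quotient) = e := ha
  replace hb : (b : c.Quotient) = e := hb
  refine (Con.eq _).2 (?_ : expansionCon (quotientLift c) _ _)
  simp only [map_mul]
  refine expansionCon_conj _ ?_ ?_ ?_
  · rw [quotientLift_toFreeMonoid, hg, IsIdempotentElem, ← WithOne.coe_mul, he.eq]
  · rw [quotientLift_toFreeMonoid, quotientLift_toFreeMonoid, hg, ha]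
  · rw [quotientLift_toFreeMonoid, quotientLift_toFreeMonoid, hg, hb]

theorem malcevProduct_pvLI_mem_expansion (V : SgPseudovariety.{u}) {A : Type u}
    (c : Con (FreeSemigroup A)) (hc : V.Mem c.Quotient) :
    (malcevProduct pvLI V).Mem (expansion c).Quotient := by
  have := V.finite_of_mem _ hc
  have hfin := finite_expansion c
  have hne : Nonempty (expansion c).Quotient := by
    obtain ⟨q⟩ := V.nonempty_of_mem _ hc
    induction q using Con.induction_on with | H w => exact ⟨w⟩
  exact ⟨hfin, hne, fun W hW => hW _ hfin hne
    ⟨c.Quotient, inferInstance, conTransitionHom (expansion_le c), hc, fun e he hf =>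
      ⟨inferInstance, hf, isLocallyTrivial_idempotentFiber_expansion c e he⟩⟩⟩

/-- In an `A`-generated semigroup, two factorizations of words that are equal in the expansion have
a common refinement. -/
theorem shift_of_expansion {A : Type*} {c : Con (FreeSemigroup A)} {u v x y : FreeSemigroup A}
    (h : expansion c (u * v) (x * y)) :
    ((u : c.Quotient) = x ∧ (v : c.Quotient) = y) ∨
      (∃ t : c.Quotient, u * t = x ∧ v = t * y) ∨
      (∃ t : c.Quotient, x * t = u ∧ y = t * v) := by
  have key {u v x y : c.Quotient} (h : Shifts ((u : WithOne c.Quotient), (v : WithOne c.Quotient))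
      ((x : WithOne c.Quotient), (y : WithOne c.Quotient))) :
      (u = x ∧ v = y) ∨ ∃ t : c.Quotient, u * t = x ∧ v = t * y := by
    obtain ⟨r, h₁, h₂⟩ := h
    cases r with
    -- A shift by the adjoined identity is the case of coinciding factorizations.
    | one =>
      exact Or.inl ⟨WithOne.coe_inj.1 ((mul_one _).symm.trans h₁),
        WithOne.coe_inj.1 (h₂.trans (one_mul _))⟩
    | coe t => exact Or.inr ⟨t, WithOne.coe_inj.1 h₁, WithOne.coe_inj.1 h₂⟩
  have hv := (expansion_iff.1 h).2
  rw [map_mul, map_mul] at hv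
  have := Shifts.of_visited_eq _ hv
  simp only [quotientLift_toFreeMonoid] at this
  rcases this with h | h
  · exact (key h).imp_right Or.inl
  · rcases key h with h | h
    · exact Or.inl ⟨h.1.symm, h.2.symm⟩
    · exact Or.inr (Or.inr h)

/-! ### The directed system of quotients in `V` -/

theorem SgPseudovariety.mem_of_injective (V : SgPseudovariety.{u}) {S T : Type u} [Semigroup S]
    [Semigroup T] [Nonempty S] (f : S →ₙ* T) (hf : Function.Injective f) (hT : V.Mem T) :
    V.Mem S := by
  have hbij : Function.Bijective f.srangeRestrict :=
    ⟨fun a b h => hf (congrArg Subtype.val h), f.srangeRestrict_surjective⟩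
  let e := (MulEquiv.ofBijective f.srangeRestrict hbij).symm
  exact V.mem_image _ _ (e : f.srange →ₙ* S) e.surjective
    (V.mem_sub T f.srange (Nonempty.map f.srangeRestrict inferInstance) hT)

/-- The quotient by the intersection embeds in the product of the two quotients. This makes the
index set of the inverse limit directed. -/
theorem SgPseudovariety.mem_inf (V : SgPseudovariety.{u}) {M : Type u} [Semigroup M]
    {c d : Con M} (hc : V.Mem c.Quotient) (hd : V.Mem d.Quotient) : V.Mem (c ⊓ d).Quotient := by
  have : Nonempty (c ⊓ d).Quotient := by
    obtain ⟨q⟩ := V.nonempty_of_mem _ hc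
    induction q using Con.induction_on with | H w => exact ⟨w⟩
  refine V.mem_of_injective ((conTransitionHom (inf_le_left : c ⊓ d ≤ c)).prod
    (conTransitionHom (inf_le_right : c ⊓ d ≤ d))) (fun p q => ?_) (V.mem_prod _ _ hc hd)
  induction p, q using Con.induction_on₂ with
  | H a b =>
    exact fun h => (Con.eq (c ⊓ d)).2 <| Con.inf_iff_and.2 ⟨(Con.eq c).1 (congrArg Prod.fst h),
      (Con.eq d).1 (congrArg Prod.snd h)⟩

theorem conTransition_trans {M : Type u} [Semigroup M] {c d e : Con M} (h : c ≤ d) (k : d ≤ e)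
    (q : c.Quotient) :
    conTransition d e k (conTransition c d h q) = conTransition c e (h.trans k) q := by
  induction q using Con.induction_on with | H w => rfl

theorem conTransition_self {M : Type u} [Semigroup M] {c : Con M} (q : c.Quotient) :
    conTransition c c le_rfl q = q := by
  induction q using Con.induction_on with | H w => rfl

/-- In a downward directed order, if everywhere one of three properties holds, and these are
inherited upwards, then one of them holds everywhere. -/
theorem forall_or_of_directed {I : Type*} [Preorder I] [IsDirected I (· ≥ ·)] {P Q R : I → Prop}
    (hP : Monotone P) (hQ : Monotone Q) (hR : Monotone R) (h : ∀ i, P i ∨ Q i ∨ R i) :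
    (∀ i, P i) ∨ (∀ i, Q i) ∨ ∀ i, R i := by
  by_contra! ⟨⟨i, hi⟩, ⟨j, hj⟩, k, hk⟩
  obtain ⟨l, hli, hlj⟩ := exists_le_le i j
  obtain ⟨m, hml, hmk⟩ := exists_le_le l k
  rcases h m with h | h | h
  · exact hi (hP (hml.trans hli) h)
  · exact hj (hQ (hml.trans hlj) h)
  · exact hk (hR hmk h)

/-! ### Passage to the inverse limit -/

section FreePro

variable {V : SgPseudovariety.{u}} {A : Type u}

/-- The elements of the `A`-generated semigroup with index `c` that shift `(u, v)` to `(x, y)`. -/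
def shiftSet (u v x y : freePro V A) (c : {c : Con (FreeSemigroup A) // V.Mem c.Quotient}) :
    Set c.1.Quotient :=
  {t | u.1 c * t = x.1 c ∧ v.1 c = t * y.1 c}

theorem conTransition_mem_shiftSet {u v x y : freePro V A}
    {c d : {c : Con (FreeSemigroup A) // V.Mem c.Quotient}} (h : c ≤ d) {t : c.1.Quotient}
    (ht : t ∈ shiftSet u v x y c) : conTransition c.1 d.1 h t ∈ shiftSet u v x y d := by
  constructor
  · rw [← u.2 c d h, ← x.2 c d h, ← conTransition_mul, ht.1]
  · rw [← v.2 c d h, ← y.2 c d h, ← conTransition_mul, ht.2]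

instance : IsDirected {c : Con (FreeSemigroup A) // V.Mem c.Quotient} (· ≥ ·) :=
  ⟨fun c d => ⟨⟨c.1 ⊓ d.1, V.mem_inf c.2 d.2⟩, (inf_le_left : c.1 ⊓ d.1 ≤ c.1),
    (inf_le_right : c.1 ⊓ d.1 ≤ d.1)⟩⟩

open CategoryTheory in
-- The shift sets form an inverse system of finite nonempty sets over a directed index set, so it
-- has a section. That compatible family is the element `t`.
theorem exists_shift {u v x y : freePro V A} (h : ∀ c, (shiftSet u v x y c).Nonempty) :
    ∃ t, u * t = x ∧ v = t * y := by
  let F : {c : Con (FreeSemigroup A) // V.Mem c.Quotient} ⥤ Type u :=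
    { obj c := shiftSet u v x y c
      map f := ↾fun t => ⟨_, conTransition_mem_shiftSet (leOfHom f) t.2⟩
      map_id c := by ext t; exact conTransition_self t.1
      map_comp f g := by
        ext t; exact (conTransition_trans (leOfHom f) (leOfHom g) t.1).symm }
  have : ∀ c, Finite (F.obj c) := fun c =>
    have := V.finite_of_mem _ c.2
    inferInstanceAs (Finite (shiftSet u v x y c))
  have : ∀ c, Nonempty (F.obj c) := fun c => (h c).to_subtype
  obtain ⟨s, hs⟩ := nonempty_sections_of_finite_cofiltered_system F
  refine ⟨⟨fun c => (s c).1, fun c d hcd => congrArg Subtype.val (hs (homOfLE hcd))⟩, ?_, ?_⟩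
  · exact Subtype.ext (funext fun c => (s c).2.1)
  · exact Subtype.ext (funext fun c => (s c).2.2)

/-- The equality is read at the finer level `expansion c`, where it forces a refinement at level
`c`. -/
theorem level_equidivisible
    (hV : ∀ c : Con (FreeSemigroup A), V.Mem c.Quotient → V.Mem (expansion c).Quotient)
    {u v x y : freePro V A} (h : u * v = x * y)
    (c : {c : Con (FreeSemigroup A) // V.Mem c.Quotient}) :
    (u.1 c = x.1 c ∧ v.1 c = y.1 c) ∨ (shiftSet u v x y c).Nonempty ∨
      (shiftSet x y u v c).Nonempty := by
  let d : {c : Con (FreeSemigroup A) // V.Mem c.Quotient} := ⟨expansion c.1, hV c.1 c.2⟩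
  have hd : d.1 ≤ c.1 := expansion_le c.1
  have hmul : u.1 d * v.1 d = x.1 d * y.1 d := congrFun (congrArg Subtype.val h) d
  -- By compatibility, a word representing `z` at level `d` also represents it at level `c`.
  have rep (z : freePro V A) : ∃ w : FreeSemigroup A, z.1 d = w ∧ z.1 c = w := by
    obtain ⟨w, hw⟩ := Quotient.exists_rep (z.1 d)
    exact ⟨w, hw.symm, by rw [← z.2 d c hd, ← hw]; rfl⟩
  obtain ⟨u', hu, hu'⟩ := rep u
  obtain ⟨v', hv, hv'⟩ := rep v
  obtain ⟨x', hx, hx'⟩ := rep x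
  obtain ⟨y', hy, hy'⟩ := rep y
  rw [hu, hv, hx, hy] at hmul
  have := shift_of_expansion ((Con.eq _).1 hmul)
  rwa [← hu', ← hv', ← hx', ← hy'] at this

end FreePro

theorem corollaryc (V : SgPseudovariety.{u}) (hV : V = malcevProduct pvLI V) :
    V.IsEquidivisible := by
  intro A _ _ u v x y h
  have hexp (c : Con (FreeSemigroup A)) (hc : V.Mem c.Quotient) :
      V.Mem (expansion c).Quotient := by
    have := malcevProduct_pvLI_mem_expansion V c hc
    rwa [← hV] at this
  have heq : Monotone fun c => u.1 c = x.1 c ∧ v.1 c = y.1 c := by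
    rintro c d hcd ⟨h₁, h₂⟩
    simp only [← u.2 c d hcd, ← v.2 c d hcd, ← x.2 c d hcd, ← y.2 c d hcd, h₁, h₂, and_self]
  have hshift (u v x y : freePro V A) : Monotone fun c => (shiftSet u v x y c).Nonempty :=
    fun c d hcd ⟨t, ht⟩ => ⟨_, conTransition_mem_shiftSet hcd ht⟩
  rcases forall_or_of_directed heq (hshift u v x y) (hshift x y u v)
    (level_equidivisible hexp h) with h | h | h
  · exact Or.inl ⟨Subtype.ext (funext fun c => (h c).1), Subtype.ext (funext fun c => (h c).2)⟩
  · exact Or.inr (Or.inl (exists_shift h))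
  · exact Or.inr (Or.inr (exists_shift h))
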